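/- Let $1<p,q<\infty$, $t_0>0$, $\lambda>0$, and write $[x]^{r-1}=\operatorname{sgn}(x)\,|x|^{r-1}$ for $x\in\mathbb R$, $r>1$. Consider the eigenvalue problem \[ ([u'']^{p-1})''=\lambda\,[u]^{q-1}\quad\text{on }[0,t_0],\qquad u(0)=u(t_0)=u''(0)=u''(t_0)=0,\qquad u\not\equiv 0, \tag{1} \] whose solutions are understood in the classical sense ($u$ and $[u'']^{p-1}$ are $C^2$ on $[0,t_0]$). Let $n\ge 1$ be an integer and let $u$ be a solution of (1) with exactly $n-1$ (distinct) zeros in $(0,t_0)$. Then these zeros are all simple (that is, $u'\neq 0$ there) and they are the points \[ t_j=\frac{j\,t_0}{n},\qquad j=1,\dots,n-1 . \] Moreover, the zeros of $u''$ in $(0,t_0)$ are exactly the same points $t_1,\dots,t_{n-1}$. Consequently $u$ is a rescaled periodic copy of the first eigenfunction, in the following sense. There exist $\mu>0$ and a solution $v$ of (1), with $\mu$ in place of $\lambda$, that is positive on $(0,t_0)$; and for every such pair $(\mu,v)$ there is a constant $c\neq 0$ such that \[ u(t)=c\,v_*(nt)\quad\text{for all }t\in[0,t_0],\qquad \lambda=n^{2p}\,|c|^{p-q}\,\mu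 , \] where $v_*:\mathbb R\to\mathbb R$ is the odd $2t_0$-periodic function that equals $v$ on $[0,t_0]$. -/

import Mathlib

open Set

noncomputable section

/-- The signed power `[x]^{r-1} = sgn(x) |x|^{r-1}`. -/
def signedPow (r x : ℝ) : ℝ := Real.sign x * |x| ^ (r - 1)

/-- The second derivative of `u` on `[0, t₀]` (one-sided at the two end points). -/
def secondDeriv (t₀ : ℝ) (u : ℝ → ℝ) : ℝ → ℝ := iteratedDerivWithin 2 u (Icc 0 t₀)

/-- `u` is a (classical, nonzero) solution on `[0, t₀]`, for the parameter `lam`, of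
`([u'']^{p-1})'' = lam [u]^{q-1}` with `u(0) = u(t₀) = u''(0) = u''(t₀) = 0`.
Only the values of `u` on `[0, t₀]` matter. -/
structure IsEigenfunction (p q lam t₀ : ℝ) (u : ℝ → ℝ) : Prop where
  contDiffOn : ContDiffOn ℝ 2 u (Icc 0 t₀)
  contDiffOn_signedPow : ContDiffOn ℝ 2 (fun t => signedPow p (secondDeriv t₀ u t)) (Icc 0 t₀)
  equation : ∀ t ∈ Icc 0 t₀,
    secondDeriv t₀ (fun s => signedPow p (secondDeriv t₀ u s)) t = lam * signedPow q (u t)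
  left : u 0 = 0
  right : u t₀ = 0
  secondDeriv_left : secondDeriv t₀ u 0 = 0
  secondDeriv_right : secondDeriv t₀ u t₀ = 0
  nonzero : ∃ t ∈ Icc 0 t₀, u t ≠ 0

/-- A first eigenfunction: a solution that is positive on `(0, t₀)`. -/
structure IsFirstEigenfunction (p q lam t₀ : ℝ) (v : ℝ → ℝ) : Prop where
  isEigenfunction : IsEigenfunction p q lam t₀ v
  pos : ∀ t ∈ Ioo 0 t₀, 0 < v t

/-- `w` is the odd, `2t₀`-periodic extension to `ℝ` of `v` restricted to `[0, t₀]`. -/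
structure IsOddPeriodicExtension (t₀ : ℝ) (v w : ℝ → ℝ) : Prop where
  odd : Function.Odd w
  periodic : Function.Periodic w (2 * t₀)
  eqOn : EqOn w v (Icc 0 t₀)

end

/-! Choose `r` with `(p - 1) * (r - 1) = 1` and put z = -[u'']^{p-1}. The equation becomes the
system u'' = -[z]^{r-1}, z'' = -lam [u]^{q-1}, and the boundary conditions let u and z extend oddly
and 2t₀-periodically to bounded solutions on the whole line (`IsEigenfunction.exists_isBoundedSol`).

Boundedness is decisive. For two solutions (u, z) and (v, w), the differences v - u and z - w make
each other convex (`IsSystemSol.isCooperative_sub`), so nonnegative initial data for them, unless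
all zero, force unbounded growth. Comparing a solution with its point reflection at a zero of u
shows that z vanishes there too, and conversely. A conserved energy is positive, which makes these
common zeros simple. Comparison also shows that the slope at 0 fixes the remaining initial datum
z'(0); uniqueness for the initial value problem survives the non-Lipschitz powers because all zeros
are simple.

Hence bounded solutions vanishing at 0 are determined by their slope. Scaling has two free
constants, enough to match the slope and the parameter, so u(t) = c v_*(κt) for any first
eigenfunction v (`IsBoundedSol.exists_scaling`). Since u(t₀) = 0, κ is an integer, and counting
zeros gives κ = n. A first eigenfunction exists: cut u at its first positive zero and rescale. -/

/-! ### The signed power: algebra, monotonicity, inverse, Lipschitz bound. -/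

lemma signedPow_zero (r : ℝ) : signedPow r 0 = 0 := by simp [signedPow]

lemma signedPow_of_pos (r : ℝ) {x : ℝ} (hx : 0 < x) : signedPow r x = x ^ (r - 1) := by
  simp [signedPow, Real.sign_of_pos hx, abs_of_pos hx]

lemma signedPow_neg (r x : ℝ) : signedPow r (-x) = -signedPow r x := by
  simp [signedPow, Real.sign_neg]

lemma signedPow_pos (r : ℝ) {x : ℝ} (hx : 0 < x) : 0 < signedPow r x := by
  rw [signedPow_of_pos r hx]; positivity

lemma signedPow_eq_zero_iff (r x : ℝ) : signedPow r x = 0 ↔ x = 0 := by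
  refine ⟨fun h => ?_, fun h => h ▸ signedPow_zero r⟩
  rcases lt_trichotomy x 0 with hx | hx | hx
  · have := signedPow_pos r (neg_pos.2 hx)
    rw [signedPow_neg] at this; linarith
  · exact hx
  · exact absurd h (signedPow_pos r hx).ne'

lemma signedPow_mul (r x y : ℝ) : signedPow r (x * y) = signedPow r x * signedPow r y := by
  have key : ∀ a b : ℝ, 0 < a → 0 < b → signedPow r (a * b) = signedPow r a * signedPow r b := by
    intro a b ha hb
    rw [signedPow_of_pos r ha, signedPow_of_pos r hb, signedPow_of_pos r (mul_pos ha hb),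
      Real.mul_rpow ha.le hb.le]
  rcases lt_trichotomy x 0 with hx | rfl | hx
  · rcases lt_trichotomy y 0 with hy | rfl | hy
    · have := key _ _ (neg_pos.2 hx) (neg_pos.2 hy)
      simpa [signedPow_neg] using this
    · simp [signedPow_zero]
    · have := key _ _ (neg_pos.2 hx) hy
      simpa [signedPow_neg] using this
  · simp [signedPow_zero]
  · rcases lt_trichotomy y 0 with hy | rfl | hy
    · have := key _ _ hx (neg_pos.2 hy)
      simpa [signedPow_neg] using this
    · simp [signedPow_zero]
    · exact key _ _ hx hy

lemma signedPow_strictMono {r : ℝ} (hr : 1 < r) : StrictMono (signedPow r) := by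
  have pos : ∀ a b : ℝ, 0 < a → a < b → signedPow r a < signedPow r b := by
    intro a b ha hab
    rw [signedPow_of_pos r ha, signedPow_of_pos r (ha.trans hab)]
    exact Real.rpow_lt_rpow ha.le hab (by linarith)
  intro x y hxy
  rcases lt_or_ge 0 x with hx | hx
  · exact pos x y hx hxy
  rcases lt_or_ge y 0 with hy | hy
  · have := pos (-y) (-x) (by linarith) (by linarith)
    simpa [signedPow_neg] using this
  have h1 : signedPow r x ≤ 0 := by
    rcases hx.lt_or_eq with h | h
    · have := signedPow_pos r (neg_pos.2 h)
      rw [signedPow_neg] at this; linarith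
    · rw [h, signedPow_zero]
  have h2 : 0 ≤ signedPow r y := by
    rcases hy.lt_or_eq with h | h
    · exact (signedPow_pos r h).le
    · rw [← h, signedPow_zero]
  refine lt_of_le_of_ne (h1.trans h2) fun h => ?_
  have ha := (signedPow_eq_zero_iff r x).1 (by linarith)
  have hb := (signedPow_eq_zero_iff r y).1 (by linarith)
  linarith

lemma signedPow_signedPow {r s : ℝ} (h : (r - 1) * (s - 1) = 1) (x : ℝ) :
    signedPow r (signedPow s x) = x := by
  have pos : ∀ a : ℝ, 0 < a → signedPow r (signedPow s a) = a := by
    intro a ha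
    rw [signedPow_of_pos s ha, signedPow_of_pos r (by positivity), ← Real.rpow_mul ha.le,
      mul_comm, h, Real.rpow_one]
  rcases lt_trichotomy x 0 with hx | rfl | hx
  · have := pos _ (neg_pos.2 hx)
    simpa [signedPow_neg] using this
  · simp [signedPow_zero]
  · exact pos x hx

lemma self_mul_signedPow {r : ℝ} (hr : 1 < r) (x : ℝ) : x * signedPow r x = |x| ^ r := by
  have pos : ∀ a : ℝ, 0 < a → a * signedPow r a = |a| ^ r := by
    intro a ha
    rw [signedPow_of_pos r ha, abs_of_pos ha, Real.rpow_sub_one ha.ne']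
    field_simp
  rcases lt_trichotomy x 0 with hx | rfl | hx
  · have := pos _ (neg_pos.2 hx)
    simpa [signedPow_neg] using this
  · simp [signedPow_zero, Real.zero_rpow (by linarith : r ≠ 0)]
  · exact pos x hx

lemma hasDerivAt_abs_rpow_div {r : ℝ} (hr : 1 < r) (x : ℝ) :
    HasDerivAt (fun x : ℝ => |x| ^ r / r) (signedPow r x) x := by
  have h := (hasDerivAt_abs_rpow x hr).div_const r
  refine h.congr_deriv ?_
  have pos : ∀ a : ℝ, 0 < a → signedPow r a = |a| ^ (r - 2) * a := by
    intro a ha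
    rw [signedPow_of_pos r ha, abs_of_pos ha, ← Real.rpow_add_one ha.ne']
    congr 1; ring
  have key : signedPow r x = |x| ^ (r - 2) * x := by
    rcases lt_trichotomy x 0 with hx | rfl | hx
    · have := pos _ (neg_pos.2 hx)
      simpa [signedPow_neg] using this
    · simp [signedPow_zero]
    · exact pos x hx
  rw [key]
  have : r ≠ 0 := by linarith
  field_simp

lemma continuous_signedPow {r : ℝ} (hr : 1 < r) : Continuous (signedPow r) := by
  have h1 : ∀ x, signedPow r x = (max x 0) ^ (r - 1) - (max (-x) 0) ^ (r - 1) := by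
    intro x
    have h0 : (0 : ℝ) ^ (r - 1) = 0 := Real.zero_rpow (by linarith)
    rcases lt_trichotomy x 0 with hx | rfl | hx
    · have := signedPow_of_pos r (neg_pos.2 hx)
      rw [signedPow_neg] at this
      rw [max_eq_right hx.le, max_eq_left (by linarith), h0]; linarith
    · simp [signedPow_zero]
    · rw [max_eq_left hx.le, max_eq_right (by linarith), h0, signedPow_of_pos r hx]; ring
  rw [funext h1]
  have h : 0 ≤ r - 1 := by linarith
  exact ((continuous_id.max continuous_const).rpow_const fun _ => Or.inr h).sub
    ((continuous_neg.max continuous_const).rpow_const fun _ => Or.inr h)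

/-- Mean value inequality, with t^{r-2} = t^{r-1} / t bounded by N^{r-1} / m, which serves r < 2 and
r ≥ 2 alike. The explicit 1/m matters: later m is proportional to the distance from a zero. -/
lemma abs_signedPow_sub_le {r : ℝ} (hr : 1 < r) {x y m N : ℝ} (hm : 0 < m) (hx : m ≤ x)
    (hy : m ≤ y) (hxN : x ≤ N) (hyN : y ≤ N) :
    |signedPow r x - signedPow r y| ≤ (r - 1) * (N ^ (r - 1) / m) * |x - y| := by
  rw [signedPow_of_pos r (hm.trans_le hx), signedPow_of_pos r (hm.trans_le hy)]
  have := Convex.norm_image_sub_le_of_norm_hasDerivWithin_le (f := fun t : ℝ => t ^ (r - 1))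
    (f' := fun t : ℝ => (r - 1) * t ^ (r - 1 - 1)) (s := Icc m N)
    (C := (r - 1) * (N ^ (r - 1) / m)) (x := y) (y := x)
    (fun t ht => (Real.hasDerivAt_rpow_const (Or.inl (hm.trans_le ht.1).ne')).hasDerivWithinAt)
    (fun t ht => by
      have ht0 : 0 < t := hm.trans_le ht.1
      rw [Real.norm_of_nonneg (mul_nonneg (by linarith) (by positivity)),
        Real.rpow_sub_one ht0.ne']
      have h1 : t ^ (r - 1) ≤ N ^ (r - 1) := Real.rpow_le_rpow ht0.le ht.2 (by linarith)
      have h2 : t ^ (r - 1) / t ≤ N ^ (r - 1) / m :=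
        div_le_div₀ (Real.rpow_nonneg (ht0.le.trans ht.2) _) h1 hm ht.1
      exact mul_le_mul_of_nonneg_left h2 (by linarith))
    (convex_Icc m N) ⟨hy, hyN⟩ ⟨hx, hxN⟩
  simpa [Real.norm_eq_abs] using this

/-! ### Cooperative second order systems -/

/-- Continuation: `step` excludes a first point where `f ≤ 0`. -/
lemma pos_of_forall_Ico_pos {f : ℝ → ℝ} (hf : Continuous f) {a : ℝ} (ha : 0 < f a)
    (step : ∀ T, a < T → (∀ t ∈ Ico a T, 0 < f t) → 0 < f T) {t : ℝ} (ht : a ≤ t) : 0 < f t := by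
  by_contra hneg
  set S : Set ℝ := Ici a ∩ f ⁻¹' Iic 0
  have hS : IsClosed S := isClosed_Ici.inter (isClosed_Iic.preimage hf)
  have hne : S.Nonempty := ⟨t, ht, not_lt.1 hneg⟩
  have hbdd : BddBelow S := ⟨a, fun x hx => hx.1⟩
  have hmem : sInf S ∈ S := hS.csInf_mem hne hbdd
  have hlt : a < sInf S := by
    refine lt_of_le_of_ne hmem.1 fun h => ?_
    have h2 : f (sInf S) ≤ 0 := hmem.2
    rw [← h] at h2
    linarith
  refine absurd (step _ hlt fun s hs => ?_) (not_lt.2 hmem.2)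
  by_contra hs0
  exact absurd (csInf_le hbdd ⟨hs.1, not_lt.1 hs0⟩) (not_le.2 hs.2)

/-- A pair `(x, y)` with derivatives `(x₁, y₁)` such that `x'' > 0` where `y > 0` and `y'' > 0`
where `x > 0`. -/
structure IsCooperative (x x₁ y y₁ : ℝ → ℝ) : Prop where
  hasDerivAt_fst : ∀ t, HasDerivAt x (x₁ t) t
  differentiable_fst : Differentiable ℝ x₁
  hasDerivAt_snd : ∀ t, HasDerivAt y (y₁ t) t
  differentiable_snd : Differentiable ℝ y₁
  deriv_fst_pos : ∀ t, 0 < y t → 0 < deriv x₁ t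
  deriv_snd_pos : ∀ t, 0 < x t → 0 < deriv y₁ t

namespace IsCooperative

variable {x x₁ y y₁ : ℝ → ℝ}

lemma symm (h : IsCooperative x x₁ y y₁) : IsCooperative y y₁ x x₁ :=
  ⟨h.hasDerivAt_snd, h.differentiable_snd, h.hasDerivAt_fst, h.differentiable_fst,
    h.deriv_snd_pos, h.deriv_fst_pos⟩

lemma differentiable (h : IsCooperative x x₁ y y₁) : Differentiable ℝ x :=
  fun t => (h.hasDerivAt_fst t).differentiableAt

/-- Where `y > 0`, the derivative `x₁` is increasing. -/
lemma strictMonoOn (h : IsCooperative x x₁ y y₁) {a b : ℝ} (hy : ∀ t ∈ Ioo a b, 0 < y t) :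
    StrictMonoOn x₁ (Icc a b) := by
  refine strictMonoOn_of_deriv_pos (convex_Icc a b) h.differentiable_fst.continuous.continuousOn ?_
  intro t ht
  rw [interior_Icc] at ht
  exact h.deriv_fst_pos t (hy t ht)

lemma strictMonoOn_fst (h : IsCooperative x x₁ y y₁) {a b : ℝ} (hx : ∀ t ∈ Ioo a b, 0 < x₁ t) :
    StrictMonoOn x (Icc a b) := by
  refine strictMonoOn_of_deriv_pos (convex_Icc a b) h.differentiable.continuous.continuousOn ?_
  intro t ht
  rw [interior_Icc] at ht
  rw [(h.hasDerivAt_fst t).deriv]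
  exact hx t ht

/-- Integrate twice. Strictness comes from `y > 0` alone, so weak inequalities at `a` suffice. -/
lemma fst_pos_of_Ico (h : IsCooperative x x₁ y y₁) {a b : ℝ} (hab : a < b) (hx : 0 ≤ x a)
    (hx₁ : 0 ≤ x₁ a) (hy : ∀ t ∈ Ioo a b, 0 < y t) : 0 < x₁ b ∧ 0 < x b := by
  have h1 := h.strictMonoOn hy
  have h2 : ∀ t ∈ Ioc a b, 0 < x₁ t := fun t ht =>
    hx₁.trans_lt (h1 ⟨le_rfl, hab.le⟩ ⟨ht.1.le, ht.2⟩ ht.1)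
  have h3 := h.strictMonoOn_fst (a := a) (b := b) fun t ht => h2 t ⟨ht.1, ht.2.le⟩
  exact ⟨h2 b ⟨hab, le_rfl⟩, hx.trans_lt (h3 ⟨le_rfl, hab.le⟩ ⟨hab.le, le_rfl⟩ hab)⟩

/-- Neither component can be the first to lose positivity, since the other one keeps it convex and
increasing until then. -/
lemma pos_of_le (h : IsCooperative x x₁ y y₁) {a : ℝ} (hx : 0 < x a) (hx₁ : 0 < x₁ a)
    (hy : 0 < y a) (hy₁ : 0 < y₁ a) {t : ℝ} (ht : a ≤ t) : 0 < x t ∧ 0 < y t := by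
  have hc : Continuous fun s => min (x s) (y s) :=
    h.differentiable.continuous.min h.symm.differentiable.continuous
  have := pos_of_forall_Ico_pos hc (a := a) (lt_min hx hy) (fun T hT hpos => by
    refine lt_min ?_ ?_
    · exact (h.fst_pos_of_Ico hT hx.le hx₁.le fun s hs =>
        (lt_min_iff.1 (hpos s ⟨hs.1.le, hs.2⟩)).2).2
    · exact (h.symm.fst_pos_of_Ico hT hy.le hy₁.le fun s hs =>
        (lt_min_iff.1 (hpos s ⟨hs.1.le, hs.2⟩)).1).2) ht
  exact lt_min_iff.1 this

/-- Since `y` stays positive, `x` is convex beyond `a` and lies above its tangent there, which has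
positive slope. -/
lemma not_bddAbove (h : IsCooperative x x₁ y y₁) {a : ℝ} (hx : 0 < x a) (hx₁ : 0 < x₁ a)
    (hy : 0 < y a) (hy₁ : 0 < y₁ a) (B : ℝ) : ∃ t, x t > B := by
  have hpos : ∀ t, a ≤ t → 0 < y t := fun t ht => (h.pos_of_le hx hx₁ hy hy₁ ht).2
  have hlin : ∀ t, a < t → x₁ a * (t - a) ≤ x t - x a := by
    intro t ht
    refine Convex.mul_sub_le_image_sub_of_le_deriv (convex_Icc a t)
      h.differentiable.continuous.continuousOn h.differentiable.differentiableOn ?_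
      a ⟨le_rfl, ht.le⟩ t ⟨ht.le, le_rfl⟩ ht.le
    intro s hs
    rw [interior_Icc] at hs
    rw [(h.hasDerivAt_fst s).deriv]
    exact (h.strictMonoOn (a := a) (b := t) fun r hr => hpos r hr.1.le).monotoneOn
      ⟨le_rfl, ht.le⟩ ⟨hs.1.le, hs.2.le⟩ hs.1.le
  refine ⟨a + (|B| + 1) / x₁ a, ?_⟩
  have h1 : 0 < (|B| + 1) / x₁ a := by positivity
  have h2 := hlin (a + (|B| + 1) / x₁ a) (by linarith)
  have h3 : x₁ a * (a + (|B| + 1) / x₁ a - a) = |B| + 1 := by field_simp; ring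
  rw [h3] at h2
  have := le_abs_self B
  linarith

end IsCooperative

/-- One linear lower bound treats a positive value and a simple zero with positive slope uniformly.
-/
lemma exists_mul_sub_le {f : ℝ → ℝ} {f' s : ℝ} (hf : HasDerivAt f f' s)
    (h : 0 < f s ∨ f s = 0 ∧ 0 < f') :
    ∃ m > 0, ∃ δ > 0, ∀ t ∈ Icc s (s + δ), m * (t - s) ≤ f t := by
  rcases h with h | ⟨h0, h⟩
  · obtain ⟨δ, hδ, hball⟩ := Metric.eventually_nhds_iff.1
      (hf.continuousAt.eventually (lt_mem_nhds (show f s / 2 < f s by linarith)))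
    refine ⟨f s / 2, by linarith, min (δ / 2) 1, by positivity, fun t ht => ?_⟩
    have h1 : t - s ≤ min (δ / 2) 1 := by linarith [ht.2]
    have h2 := hball (y := t) (by
      rw [Real.dist_eq, abs_of_nonneg (by linarith [ht.1])]
      linarith [min_le_left (δ / 2) 1])
    have h3 : t - s ≤ 1 := h1.trans (min_le_right _ _)
    nlinarith [ht.1]
  · obtain ⟨δ, hδ, hball⟩ := Metric.eventually_nhds_iff.1
      ((hasDerivAt_iff_isLittleO.1 hf).def (show 0 < f' / 2 by linarith))
    refine ⟨f' / 2, by linarith, δ / 2, by positivity, fun t ht => ?_⟩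
    have h2 := hball (y := t) (by
      rw [Real.dist_eq, abs_of_nonneg (by linarith [ht.1])]
      linarith [ht.2])
    rw [Real.norm_eq_abs, Real.norm_eq_abs, abs_of_nonneg (by linarith [ht.1] : 0 ≤ t - s),
      smul_eq_mul, h0] at h2
    have := (abs_le.1 h2).1
    linarith

/-- A cooperative pair that is bounded and starts in the positive cone starts at the vertex of the
cone. -/
lemma IsCooperative.not_pos_of_bddAbove {x x₁ y y₁ : ℝ → ℝ} (h : IsCooperative x x₁ y y₁)
    {B : ℝ} (hB : ∀ t, x t ≤ B) (hx : 0 ≤ x 0) (hx₁ : 0 ≤ x₁ 0) (hy : 0 ≤ y 0)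
    (hy₁ : 0 ≤ y₁ 0) : ¬ (0 < y 0 ∨ 0 < y₁ 0) := by
  intro hpos
  have hstart : 0 < y 0 ∨ y 0 = 0 ∧ 0 < y₁ 0 := by
    rcases hy.lt_or_eq with h0 | h0
    · exact Or.inl h0
    · exact Or.inr ⟨h0.symm, hpos.resolve_left h0.not_lt⟩
  obtain ⟨m, hm, δ, hδ, hle⟩ := exists_mul_sub_le (h.hasDerivAt_snd 0) hstart
  have hy' : ∀ t ∈ Ioc 0 δ, 0 < y t := fun t ht =>
    lt_of_lt_of_le (mul_pos hm (by linarith [ht.1])) (hle t ⟨ht.1.le, by linarith [ht.2]⟩)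
  have hx' : ∀ t ∈ Ioc 0 δ, 0 < x₁ t ∧ 0 < x t := fun t ht =>
    h.fst_pos_of_Ico ht.1 hx hx₁ fun s hs => hy' s ⟨hs.1, hs.2.le.trans ht.2⟩
  have hy'' := h.symm.fst_pos_of_Ico hδ hy hy₁ fun s hs => (hx' s ⟨hs.1, hs.2.le⟩).2
  obtain ⟨t, ht⟩ := h.not_bddAbove (hx' δ ⟨hδ, le_rfl⟩).2 (hx' δ ⟨hδ, le_rfl⟩).1 hy''.2 hy''.1 B
  exact absurd (hB t) (not_le.2 ht)

/-! ### Solutions on the real line of `u'' = -[z]^{r-1}`, `z'' = -lam [u]^{q-1}` -/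

/-- `u`, `z`, with derivatives `u₁`, `z₁`, solve `u'' = -[z]^{r-1}`, `z'' = -lam [u]^{q-1}`. -/
structure IsSystemSol (r q lam : ℝ) (u u₁ z z₁ : ℝ → ℝ) : Prop where
  hasDerivAt_u : ∀ t, HasDerivAt u (u₁ t) t
  hasDerivAt_u₁ : ∀ t, HasDerivAt u₁ (-signedPow r (z t)) t
  hasDerivAt_z : ∀ t, HasDerivAt z (z₁ t) t
  hasDerivAt_z₁ : ∀ t, HasDerivAt z₁ (-(lam * signedPow q (u t))) t

/-- The difference of two functions with the same initial data, and a nonzero initial value or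
derivative, is well behaved under `signedPow`. -/
lemma exists_abs_signedPow_sub_le {r : ℝ} (hr : 1 < r) {f f₁ g g₁ : ℝ → ℝ}
    (hf : ∀ t, HasDerivAt f (f₁ t) t) (hg : ∀ t, HasDerivAt g (g₁ t) t) {s : ℝ}
    (h0 : f s = g s) (h1 : f₁ s = g₁ s) (hne : f s = 0 → f₁ s ≠ 0) :
    ∃ C ≥ 0, ∃ δ > 0, ∀ t ∈ Icc s (s + δ), ∀ M, 0 ≤ M → |f t - g t| ≤ M * (t - s) →
      |signedPow r (f t) - signedPow r (g t)| ≤ C * M := by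
  have main : ∀ f f₁ g g₁ : ℝ → ℝ, (∀ t, HasDerivAt f (f₁ t) t) → (∀ t, HasDerivAt g (g₁ t) t) →
      f s = g s → f₁ s = g₁ s → (0 < f s ∨ f s = 0 ∧ 0 < f₁ s) →
      ∃ C ≥ 0, ∃ δ > 0, ∀ t ∈ Icc s (s + δ), ∀ M, 0 ≤ M → |f t - g t| ≤ M * (t - s) →
      |signedPow r (f t) - signedPow r (g t)| ≤ C * M := by
    intro f f₁ g g₁ hf hg h0 h1 hpos
    obtain ⟨m, hm, δ, hδ, hfm⟩ := exists_mul_sub_le (hf s) hpos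
    obtain ⟨m', hm', δ', hδ', hgm⟩ := exists_mul_sub_le (hg s) (h0 ▸ h1 ▸ hpos)
    have hfc : Continuous f := continuous_iff_continuousAt.2 fun t => (hf t).continuousAt
    have hgc : Continuous g := continuous_iff_continuousAt.2 fun t => (hg t).continuousAt
    obtain ⟨N, hN⟩ := (isCompact_Icc (a := s) (b := s + min δ δ')).exists_bound_of_continuousOn
      (hfc.prodMk hgc).continuousOn
    have hN0 : 0 ≤ N := (norm_nonneg _).trans (hN s ⟨le_rfl, by simp [hδ.le, hδ'.le]⟩)
    have hr1 : 0 ≤ r - 1 := by linarith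
    refine ⟨(r - 1) * (N ^ (r - 1) / min m m'), by positivity, min δ δ', by positivity, ?_⟩
    intro t ht M hM hle
    -- On the values of `f` and `g` at `t`, both at least `min m m' * (t - s)`, the Lipschitz
    -- constant is of order 1 / (t - s); the factor `t - s` in the bound on `|f t - g t|` cancels
    -- it.
    rcases ht.1.eq_or_lt with rfl | hst
    · rw [h0, sub_self, abs_zero]; positivity
    have hτ : 0 < t - s := sub_pos.2 hst
    have hb := hN t ht
    rw [Prod.norm_def, max_le_iff, Real.norm_eq_abs, Real.norm_eq_abs] at hb
    have hmm : 0 < min m m' := lt_min hm hm'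
    have hA := abs_signedPow_sub_le hr (mul_pos hmm hτ)
      ((mul_le_mul_of_nonneg_right (min_le_left m m') hτ.le).trans
        (hfm t ⟨ht.1, ht.2.trans (by linarith [min_le_left δ δ'])⟩))
      ((mul_le_mul_of_nonneg_right (min_le_right m m') hτ.le).trans
        (hgm t ⟨ht.1, ht.2.trans (by linarith [min_le_right δ δ'])⟩))
      ((le_abs_self _).trans hb.1) ((le_abs_self _).trans hb.2)
    refine hA.trans ((mul_le_mul_of_nonneg_left hle (by positivity)).trans (le_of_eq ?_))
    field_simp
  by_cases hpos : 0 < f s ∨ f s = 0 ∧ 0 < f₁ s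
  · exact main f f₁ g g₁ hf hg h0 h1 hpos
  · have hneg : 0 < -f s ∨ -f s = 0 ∧ 0 < -f₁ s := by
      rcases lt_trichotomy (f s) 0 with h | h | h
      · exact Or.inl (by linarith)
      · refine Or.inr ⟨by linarith, ?_⟩
        rcases lt_or_gt_of_ne (hne h) with h' | h'
        · linarith
        · exact absurd (Or.inr ⟨h, h'⟩) hpos
      · exact absurd (Or.inl h) hpos
    obtain ⟨C, hC, δ, hδ, H⟩ := main (fun t => -f t) (fun t => -f₁ t) (fun t => -g t)
      (fun t => -g₁ t) (fun t => (hf t).neg) (fun t => (hg t).neg) (by simp [h0]) (by simp [h1]) hneg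
    refine ⟨C, hC, δ, hδ, fun t ht M hM hle => ?_⟩
    have := H t ht M hM (by rw [← abs_neg]; convert hle using 2; ring)
    rw [signedPow_neg, signedPow_neg, ← abs_neg] at this
    convert this using 2; ring

lemma abs_sub_le_mul_of_deriv_bound {f f' : ℝ → ℝ} (hf : ∀ t, HasDerivAt f (f' t) t) {a b C : ℝ}
    (h0 : f a = 0) (hC : ∀ t ∈ Icc a b, |f' t| ≤ C) {t : ℝ} (ht : t ∈ Icc a b) :
    |f t| ≤ C * (t - a) := by
  have := norm_image_sub_le_of_norm_deriv_le_segment' (f := f) (f' := f') (a := a) (b := b) (C := C)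
    (fun x _ => (hf x).hasDerivWithinAt) (fun x hx => hC x ⟨hx.1, hx.2.le⟩) t ht
  simpa [h0] using this

namespace IsSystemSol

variable {r q lam : ℝ} {u u₁ z z₁ v v₁ w w₁ : ℝ → ℝ}

/-- Let M be the maximum of |u₁ - v₁| and |z₁ - w₁| on a short interval. Integration bounds |u - v|
and |z - w| by M(t - s), hence the differences of signed powers by a multiple of M; integrating
again gives M ≤ M/2, so M = 0. -/
lemma eq_near (hr : 1 < r) (hq : 1 < q) (hu : IsSystemSol r q lam u u₁ z z₁)
    (hv : IsSystemSol r q lam v v₁ w w₁) (hnu : ∀ t, u t = 0 → u₁ t ≠ 0)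
    (hnz : ∀ t, z t = 0 → z₁ t ≠ 0) {s : ℝ} (h1 : u s = v s) (h2 : u₁ s = v₁ s) (h3 : z s = w s)
    (h4 : z₁ s = w₁ s) :
    ∃ δ > 0, ∀ t ∈ Icc s (s + δ), u t = v t ∧ u₁ t = v₁ t ∧ z t = w t ∧ z₁ t = w₁ t := by
  obtain ⟨C, hC, δ, hδ, H⟩ :=
    exists_abs_signedPow_sub_le hq hu.hasDerivAt_u hv.hasDerivAt_u h1 h2 (hnu s)
  obtain ⟨C', hC', δ', hδ', H'⟩ :=
    exists_abs_signedPow_sub_le hr hu.hasDerivAt_z hv.hasDerivAt_z h3 h4 (hnz s)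
  set K : ℝ := |lam| * C + C' with hK
  have hK0 : 0 ≤ K := by positivity
  set ε : ℝ := min (min δ δ') (1 / (2 * (K + 1))) with hε
  have hε0 : 0 < ε := by positivity
  have hεδ : ε ≤ δ := (min_le_left _ _).trans (min_le_left _ _)
  have hεδ' : ε ≤ δ' := (min_le_left _ _).trans (min_le_right _ _)
  have hKε : K * ε ≤ 1 / 2 := by
    have h := mul_le_mul_of_nonneg_left (min_le_right (min δ δ') (1 / (2 * (K + 1)))) hK0
    refine h.trans ?_
    rw [mul_one_div, div_le_div_iff₀ (by positivity) (by norm_num)]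
    linarith
  have hd := fun t => (hu.hasDerivAt_u t).sub (hv.hasDerivAt_u t)
  have hd₁ := fun t => (hu.hasDerivAt_u₁ t).sub (hv.hasDerivAt_u₁ t)
  have he := fun t => (hu.hasDerivAt_z t).sub (hv.hasDerivAt_z t)
  have he₁ := fun t => (hu.hasDerivAt_z₁ t).sub (hv.hasDerivAt_z₁ t)
  have hcd : Continuous (u₁ - v₁) := continuous_iff_continuousAt.2 fun t => (hd₁ t).continuousAt
  have hce : Continuous (z₁ - w₁) := continuous_iff_continuousAt.2 fun t => (he₁ t).continuousAt
  obtain ⟨t₀, ht₀, hmax⟩ := (isCompact_Icc (a := s) (b := s + ε)).exists_isMaxOn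
    ⟨s, le_rfl, by linarith⟩ (hcd.abs.max hce.abs).continuousOn
  set M : ℝ := max (|(u₁ - v₁) t₀|) (|(z₁ - w₁) t₀|) with hMdef
  have hM0 : 0 ≤ M := (abs_nonneg _).trans (le_max_left _ _)
  have hM : ∀ t ∈ Icc s (s + ε), |u₁ t - v₁ t| ≤ M ∧ |z₁ t - w₁ t| ≤ M := fun t ht =>
    max_le_iff.1 (hmax ht)
  have hdM : ∀ t ∈ Icc s (s + ε), |u t - v t| ≤ M * (t - s) := fun t ht =>
    abs_sub_le_mul_of_deriv_bound hd (by simp [h1]) (fun t ht => (hM t ht).1) ht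
  have heM : ∀ t ∈ Icc s (s + ε), |z t - w t| ≤ M * (t - s) := fun t ht =>
    abs_sub_le_mul_of_deriv_bound he (by simp [h3]) (fun t ht => (hM t ht).2) ht
  have hd₁M : ∀ t ∈ Icc s (s + ε), |u₁ t - v₁ t| ≤ K * M * (t - s) := fun t ht =>
    abs_sub_le_mul_of_deriv_bound hd₁ (by simp [h2]) (fun t ht => by
      have := H' t ⟨ht.1, by linarith [ht.2]⟩ M hM0 (heM t ht)
      rw [show -signedPow r (z t) - -signedPow r (w t) =
        -(signedPow r (z t) - signedPow r (w t)) by ring, abs_neg]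
      refine this.trans (mul_le_mul_of_nonneg_right ?_ hM0)
      rw [hK]; nlinarith [abs_nonneg lam]) ht
  have he₁M : ∀ t ∈ Icc s (s + ε), |z₁ t - w₁ t| ≤ K * M * (t - s) := fun t ht =>
    abs_sub_le_mul_of_deriv_bound he₁ (by simp [h4]) (fun t ht => by
      have := H t ⟨ht.1, by linarith [ht.2]⟩ M hM0 (hdM t ht)
      rw [show -(lam * signedPow q (u t)) - -(lam * signedPow q (v t)) =
        -(lam * (signedPow q (u t) - signedPow q (v t))) by ring, abs_neg, abs_mul]
      refine (mul_le_mul_of_nonneg_left this (abs_nonneg _)).trans ?_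
      rw [hK]; nlinarith [mul_nonneg hC' hM0]) ht
  have hMle : M ≤ K * M * (t₀ - s) := max_le (hd₁M t₀ ht₀) (he₁M t₀ ht₀)
  have hMz : M = 0 := by
    have h5 : K * M * (t₀ - s) ≤ K * M * ε :=
      mul_le_mul_of_nonneg_left (by linarith [ht₀.2]) (by positivity)
    nlinarith
  refine ⟨ε, hε0, fun t ht => ?_⟩
  have a1 := hM t ht
  have a2 := hdM t ht
  have a3 := heM t ht
  rw [hMz] at a1
  rw [hMz, zero_mul] at a2 a3
  exact ⟨sub_eq_zero.1 (abs_nonpos_iff.1 a2), sub_eq_zero.1 (abs_nonpos_iff.1 a1.1),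
    sub_eq_zero.1 (abs_nonpos_iff.1 a3), sub_eq_zero.1 (abs_nonpos_iff.1 a1.2)⟩

lemma continuous_all (hu : IsSystemSol r q lam u u₁ z z₁) :
    Continuous u ∧ Continuous u₁ ∧ Continuous z ∧ Continuous z₁ :=
  ⟨continuous_iff_continuousAt.2 fun t => (hu.hasDerivAt_u t).continuousAt,
    continuous_iff_continuousAt.2 fun t => (hu.hasDerivAt_u₁ t).continuousAt,
    continuous_iff_continuousAt.2 fun t => (hu.hasDerivAt_z t).continuousAt,
    continuous_iff_continuousAt.2 fun t => (hu.hasDerivAt_z₁ t).continuousAt⟩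

/-- Uniqueness for the initial value problem, for a solution with only simple zeros. -/
lemma eq_of_initial_eq (hr : 1 < r) (hq : 1 < q) (hu : IsSystemSol r q lam u u₁ z z₁)
    (hv : IsSystemSol r q lam v v₁ w w₁) (hnu : ∀ t, u t = 0 → u₁ t ≠ 0)
    (hnz : ∀ t, z t = 0 → z₁ t ≠ 0) {s : ℝ} (h1 : u s = v s) (h2 : u₁ s = v₁ s) (h3 : z s = w s)
    (h4 : z₁ s = w₁ s) {t : ℝ} (ht : s ≤ t) : u t = v t := by
  obtain ⟨c1, c2, c3, c4⟩ := hu.continuous_all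
  obtain ⟨d1, d2, d3, d4⟩ := hv.continuous_all
  set S : Set ℝ := {t | u t = v t ∧ u₁ t = v₁ t ∧ z t = w t ∧ z₁ t = w₁ t} with hS
  have hclosed : IsClosed S := (isClosed_eq c1 d1).inter ((isClosed_eq c2 d2).inter
    ((isClosed_eq c3 d3).inter (isClosed_eq c4 d4)))
  -- Continuous induction: the agreement set is closed and `eq_near` extends it to the right.
  have hsub : Icc s t ⊆ S := by
    refine (hclosed.inter isClosed_Icc).Icc_subset_of_forall_exists_gt ⟨h1, h2, h3, h4⟩ ?_
    rintro x ⟨⟨k1, k2, k3, k4⟩, -⟩ y hy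
    obtain ⟨δ, hδ, H⟩ := eq_near hr hq hu hv hnu hnz k1 k2 k3 k4
    have hxy : x < y := hy
    refine ⟨min y (x + δ), H _ ⟨?_, min_le_right _ _⟩, ?_, min_le_left _ _⟩
    · exact le_min hxy.le (by linarith)
    · exact lt_min hxy (by linarith)
  exact (hsub ⟨ht, le_rfl⟩).1

end IsSystemSol

namespace IsSystemSol

variable {r q lam : ℝ} {u u₁ z z₁ v v₁ w w₁ : ℝ → ℝ}

lemma shift (hu : IsSystemSol r q lam u u₁ z z₁) (s : ℝ) :
    IsSystemSol r q lam (fun t => u (s + t)) (fun t => u₁ (s + t)) (fun t => z (s + t))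
      (fun t => z₁ (s + t)) :=
  ⟨fun t => (hu.hasDerivAt_u _).comp_const_add s t, fun t => (hu.hasDerivAt_u₁ _).comp_const_add s t,
    fun t => (hu.hasDerivAt_z _).comp_const_add s t, fun t => (hu.hasDerivAt_z₁ _).comp_const_add s t⟩

/-- The nonlinearities are odd, so point reflection preserves the system. At `t = 0` the slopes
coincide with those of `shift`, while the values change sign. -/
lemma reflect (hu : IsSystemSol r q lam u u₁ z z₁) (s : ℝ) :
    IsSystemSol r q lam (fun t => -u (s - t)) (fun t => u₁ (s - t)) (fun t => -z (s - t))
      (fun t => z₁ (s - t)) := by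
  refine ⟨fun t => ?_, fun t => ?_, fun t => ?_, fun t => ?_⟩
  · simpa using ((hu.hasDerivAt_u _).comp_const_sub s t).fun_neg
  · simpa [signedPow_neg] using (hu.hasDerivAt_u₁ _).comp_const_sub s t
  · simpa using ((hu.hasDerivAt_z _).comp_const_sub s t).fun_neg
  · simpa [signedPow_neg] using (hu.hasDerivAt_z₁ _).comp_const_sub s t

/-- The two differences are taken in opposite order to absorb the minus signs of the system. -/
lemma isCooperative_sub (hr : 1 < r) (hq : 1 < q) (hlam : 0 < lam)
    (hu : IsSystemSol r q lam u u₁ z z₁) (hv : IsSystemSol r q lam v v₁ w w₁) :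
    IsCooperative (v - u) (v₁ - u₁) (z - w) (z₁ - w₁) := by
  have h1 := fun t => (hv.hasDerivAt_u₁ t).sub (hu.hasDerivAt_u₁ t)
  have h2 := fun t => (hu.hasDerivAt_z₁ t).sub (hv.hasDerivAt_z₁ t)
  refine ⟨fun t => (hv.hasDerivAt_u t).sub (hu.hasDerivAt_u t),
    fun t => (h1 t).differentiableAt, fun t => (hu.hasDerivAt_z t).sub (hv.hasDerivAt_z t),
    fun t => (h2 t).differentiableAt, fun t ht => ?_, fun t ht => ?_⟩
  · rw [(h1 t).deriv]
    have := signedPow_strictMono hr (sub_pos.1 ht)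
    linarith
  · rw [(h2 t).deriv]
    have := mul_lt_mul_of_pos_left (signedPow_strictMono hq (sub_pos.1 ht)) hlam
    linarith

lemma eq_of_le_snd (hr : 1 < r) (hq : 1 < q) (hlam : 0 < lam)
    (hu : IsSystemSol r q lam u u₁ z z₁) (hv : IsSystemSol r q lam v v₁ w w₁) {A B : ℝ}
    (hA : ∀ t, |u t| ≤ A) (hB : ∀ t, |v t| ≤ B) (h1 : u 0 = v 0) (h2 : u₁ 0 = v₁ 0)
    (h3 : w 0 ≤ z 0) (h4 : w₁ 0 ≤ z₁ 0) : w 0 = z 0 ∧ w₁ 0 = z₁ 0 := by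
  have h := (isCooperative_sub hr hq hlam hu hv).not_pos_of_bddAbove (B := B + A)
    (fun t => by
      have a1 := (abs_le.1 (hA t)).1
      have a2 := (abs_le.1 (hB t)).2
      simp only [Pi.sub_apply]; linarith)
    (by simp [h1]) (by simp [h2]) (by simpa using h3) (by simpa using h4)
  simp only [Pi.sub_apply, sub_pos, not_or, not_lt] at h
  exact ⟨le_antisymm h3 h.1, le_antisymm h4 h.2⟩

lemma eq_of_le_fst (hr : 1 < r) (hq : 1 < q) (hlam : 0 < lam)
    (hu : IsSystemSol r q lam u u₁ z z₁) (hv : IsSystemSol r q lam v v₁ w w₁) {A B : ℝ}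
    (hA : ∀ t, |z t| ≤ A) (hB : ∀ t, |w t| ≤ B) (h1 : u 0 ≤ v 0) (h2 : u₁ 0 ≤ v₁ 0)
    (h3 : w 0 = z 0) (h4 : w₁ 0 = z₁ 0) : u 0 = v 0 := by
  have h := (isCooperative_sub hr hq hlam hu hv).symm.not_pos_of_bddAbove (B := B + A)
    (fun t => by
      have a1 := (abs_le.1 (hA t)).2
      have a2 := (abs_le.1 (hB t)).1
      simp only [Pi.sub_apply]; linarith)
    (by simp [h3]) (by simp [h4]) (by simpa using h1) (by simpa using h2)
  simp only [Pi.sub_apply, sub_pos, not_or, not_lt] at h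
  exact le_antisymm h1 h.1

/-- This is the Hamiltonian of the system: the derivatives of the two power terms cancel that of
u'z'. -/
lemma energy_eq (hr : 1 < r) (hq : 1 < q) (hu : IsSystemSol r q lam u u₁ z z₁) (s t : ℝ) :
    u₁ s * z₁ s + lam * (|u s| ^ q / q) + |z s| ^ r / r =
      u₁ t * z₁ t + lam * (|u t| ^ q / q) + |z t| ^ r / r := by
  have hd : ∀ t, HasDerivAt
      (fun t => u₁ t * z₁ t + lam * (|u t| ^ q / q) + |z t| ^ r / r) 0 t := by
    intro t
    have h1 := (hu.hasDerivAt_u₁ t).mul (hu.hasDerivAt_z₁ t)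
    have h2 := ((hasDerivAt_abs_rpow_div hq (u t)).comp t (hu.hasDerivAt_u t)).const_mul lam
    have h3 := (hasDerivAt_abs_rpow_div hr (z t)).comp t (hu.hasDerivAt_z t)
    refine ((h1.add h2).add h3).congr_deriv ?_
    ring
  exact is_const_of_deriv_eq_zero (fun t => (hd t).differentiableAt) (fun t => (hd t).deriv) s t

/-- A nontrivial solution that vanishes at the ends of an interval has positive energy. -/
lemma energy_pos (hr : 1 < r) (hq : 1 < q) (hlam : 0 < lam)
    (hu : IsSystemSol r q lam u u₁ z z₁) {T : ℝ} (hz0 : z 0 = 0) (hzT : z T = 0)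
    {s : ℝ} (hs : s ∈ Ioo 0 T) (hus : u s ≠ 0) (t : ℝ) :
    0 < u₁ t * z₁ t + lam * (|u t| ^ q / q) + |z t| ^ r / r := by
  by_contra hneg
  rw [hu.energy_eq hr hq t s] at hneg
  -- Nonpositive energy makes u'z nonincreasing. It vanishes at 0 and T, so it is zero in between,
  -- but its derivative is strictly negative where u ≠ 0.
  have hd : ∀ t, HasDerivAt (fun t => u₁ t * z t) (u₁ t * z₁ t - |z t| ^ r) t := by
    intro t
    refine ((hu.hasDerivAt_u₁ t).mul (hu.hasDerivAt_z t)).congr_deriv ?_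
    rw [← self_mul_signedPow hr]; ring
  have hle : ∀ t, u₁ t * z₁ t - |z t| ^ r ≤ -(lam * (|u t| ^ q / q)) := by
    intro t
    have h1 : 0 ≤ |z t| ^ r / r := by positivity
    have h2 : 0 ≤ |z t| ^ r := by positivity
    rw [hu.energy_eq hr hq s t] at hneg
    linarith
  have hnonneg : ∀ t, 0 ≤ lam * (|u t| ^ q / q) := fun t => by positivity
  have hanti : Antitone fun t => u₁ t * z t :=
    antitone_of_deriv_nonpos (fun t => (hd t).differentiableAt) fun t => by
      rw [(hd t).deriv]; linarith [hle t, hnonneg t]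
  have hconst : ∀ t ∈ Ioo 0 T, u₁ t * z t = 0 := by
    intro t ht
    have h1 := hanti ht.1.le
    have h2 := hanti ht.2.le
    simp only [hz0, hzT, mul_zero] at h1 h2
    linarith
  have hz : HasDerivAt (fun t => u₁ t * z t) 0 s :=
    (hasDerivAt_const s (0 : ℝ)).congr_of_eventuallyEq
      (Filter.eventually_of_mem (Ioo_mem_nhds hs.1 hs.2) hconst)
  have h0 := (hd s).unique hz
  have hpos : 0 < lam * (|u s| ^ q / q) := by
    have : 0 < |u s| := abs_pos.2 hus
    positivity
  linarith [hle s]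

/-- The factor of `z` is forced by z = -[u'']^{p-1}, as u'' is multiplied by cκ². -/
lemma scale {p : ℝ} (hpr : (p - 1) * (r - 1) = 1)
    (hu : IsSystemSol r q lam u u₁ z z₁) {κ c : ℝ} (hκ : 0 < κ) (hc : c ≠ 0) :
    IsSystemSol r q (κ ^ (2 * p) * |c| ^ (p - q) * lam) (fun t => c * u (κ * t))
      (fun t => c * κ * u₁ (κ * t)) (fun t => signedPow p c * κ ^ (2 * (p - 1)) * z (κ * t))
      (fun t => signedPow p c * κ ^ (2 * (p - 1)) * κ * z₁ (κ * t)) := by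
  have hlin : ∀ t, HasDerivAt (fun t : ℝ => κ * t) κ t := fun t => by
    simpa using (hasDerivAt_id t).const_mul κ
  refine ⟨fun t => ?_, fun t => ?_, fun t => ?_, fun t => ?_⟩
  · refine (((hu.hasDerivAt_u _).comp t (hlin t)).const_mul c).congr_deriv (by ring)
  · refine (((hu.hasDerivAt_u₁ _).comp t (hlin t)).const_mul (c * κ)).congr_deriv ?_
    rw [signedPow_mul, signedPow_mul, signedPow_signedPow (by rw [mul_comm]; exact hpr),
      signedPow_of_pos r (Real.rpow_pos_of_pos hκ _), ← Real.rpow_mul hκ.le,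
      show 2 * (p - 1) * (r - 1) = (2 : ℕ) by push_cast; linarith, Real.rpow_natCast]
    ring
  · refine (((hu.hasDerivAt_z _).comp t (hlin t)).const_mul _).congr_deriv (by ring)
  · refine (((hu.hasDerivAt_z₁ _).comp t (hlin t)).const_mul _).congr_deriv ?_
    have h1 : signedPow p c = |c| ^ (p - q) * signedPow q c := by
      rw [signedPow, signedPow, show p - 1 = (p - q) + (q - 1) by ring,
        Real.rpow_add (abs_pos.2 hc)]
      ring
    have h2 : κ ^ (2 * p) = κ ^ (2 * (p - 1)) * κ * κ := by
      rw [show 2 * p = 2 * (p - 1) + (2 : ℕ) by push_cast; ring, Real.rpow_add hκ,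
        Real.rpow_natCast]
      ring
    rw [signedPow_mul, h1, h2]
    ring

end IsSystemSol

/-- A bounded solution on the real line that vanishes at `0` and `T` and is nontrivial between. -/
structure IsBoundedSol (r q lam T : ℝ) (u u₁ z z₁ : ℝ → ℝ) : Prop where
  sol : IsSystemSol r q lam u u₁ z z₁
  u_zero : u 0 = 0
  z_zero : z 0 = 0
  u_right : u T = 0
  z_right : z T = 0
  bounded_u : ∃ B, ∀ t, |u t| ≤ B
  bounded_z : ∃ B, ∀ t, |z t| ≤ B
  nonzero : ∃ t ∈ Ioo 0 T, u t ≠ 0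

/-! ### Bounded solutions: common simple zeros, determination by the slope, scaling -/

namespace IsBoundedSol

variable {r q lam T : ℝ} {u u₁ z z₁ v v₁ w w₁ : ℝ → ℝ}

/-- At a zero `s` of `u`, the shift by `s` and the point reflection there agree in `u`, `u₁` and
`z₁`, and their `z`-values are `z s` and `-z s`. These are ordered one way or the other, so
comparison makes them equal. -/
lemma z_eq_zero (hr : 1 < r) (hq : 1 < q) (hlam : 0 < lam)
    (h : IsBoundedSol r q lam T u u₁ z z₁) {s : ℝ} (hs : u s = 0) : z s = 0 := by
  obtain ⟨B, hB⟩ := h.bounded_u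
  have h1 := h.sol.shift s
  have h2 := h.sol.reflect s
  rcases le_total 0 (z s) with hz | hz
  · have := (h1.eq_of_le_snd hr hq hlam h2 (fun t => hB _) (fun t => by rw [abs_neg]; exact hB _)
      (by simp [hs]) (by simp) (by simp; linarith) (by simp)).1
    simp at this; linarith
  · have := (h2.eq_of_le_snd hr hq hlam h1 (fun t => by rw [abs_neg]; exact hB _) (fun t => hB _)
      (by simp [hs]) (by simp) (by simp; linarith) (by simp)).1
    simp at this; linarith

lemma u_eq_zero (hr : 1 < r) (hq : 1 < q) (hlam : 0 < lam)
    (h : IsBoundedSol r q lam T u u₁ z z₁) {s : ℝ} (hs : z s = 0) : u s = 0 := by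
  obtain ⟨B, hB⟩ := h.bounded_z
  have h1 := h.sol.shift s
  have h2 := h.sol.reflect s
  rcases le_total 0 (u s) with hz | hz
  · have := h2.eq_of_le_fst hr hq hlam h1 (fun t => by rw [abs_neg]; exact hB _) (fun t => hB _)
      (by simp; linarith) (by simp) (by simp [hs]) (by simp)
    simp at this; linarith
  · have := h1.eq_of_le_fst hr hq hlam h2 (fun t => hB _) (fun t => by rw [abs_neg]; exact hB _)
      (by simp; linarith) (by simp) (by simp [hs]) (by simp)
    simp at this; linarith

lemma u_eq_zero_iff (hr : 1 < r) (hq : 1 < q) (hlam : 0 < lam)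
    (h : IsBoundedSol r q lam T u u₁ z z₁) (s : ℝ) : u s = 0 ↔ z s = 0 :=
  ⟨h.z_eq_zero hr hq hlam, h.u_eq_zero hr hq hlam⟩

/-- At a common zero the positive energy reduces to u'z'. -/
lemma deriv_mul_pos (hr : 1 < r) (hq : 1 < q) (hlam : 0 < lam)
    (h : IsBoundedSol r q lam T u u₁ z z₁) {s : ℝ} (hs : u s = 0) : 0 < u₁ s * z₁ s := by
  obtain ⟨t, ht, hne⟩ := h.nonzero
  have := h.sol.energy_pos hr hq hlam h.z_zero h.z_right ht hne s
  rw [hs, h.z_eq_zero hr hq hlam hs, abs_zero, Real.zero_rpow (by linarith),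
    Real.zero_rpow (by linarith)] at this
  simpa using this

lemma u₁_ne_zero (hr : 1 < r) (hq : 1 < q) (hlam : 0 < lam)
    (h : IsBoundedSol r q lam T u u₁ z z₁) {s : ℝ} (hs : u s = 0) : u₁ s ≠ 0 :=
  left_ne_zero_of_mul (h.deriv_mul_pos hr hq hlam hs).ne'

lemma z₁_ne_zero (hr : 1 < r) (hq : 1 < q) (hlam : 0 < lam)
    (h : IsBoundedSol r q lam T u u₁ z z₁) {s : ℝ} (hs : z s = 0) : z₁ s ≠ 0 :=
  right_ne_zero_of_mul (h.deriv_mul_pos hr hq hlam (h.u_eq_zero hr hq hlam hs)).ne'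

/-- A bounded solution is determined by its slope at `0`, among the bounded solutions for the same
parameter. -/
lemma eq_of_slope_eq (hr : 1 < r) (hq : 1 < q) (hlam : 0 < lam)
    (h : IsBoundedSol r q lam T u u₁ z z₁) (hv : IsSystemSol r q lam v v₁ w w₁)
    (hv0 : v 0 = 0) (hw0 : w 0 = 0) {B : ℝ} (hB : ∀ t, |v t| ≤ B) (hslope : u₁ 0 = v₁ 0)
    {t : ℝ} (ht : 0 ≤ t) : u t = v t := by
  obtain ⟨A, hA⟩ := h.bounded_u
  have huv : u 0 = v 0 := by rw [h.u_zero, hv0]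
  have hzw : z 0 = w 0 := by rw [h.z_zero, hw0]
  -- All other initial data agree, so whichever order the two slopes have, comparison applies.
  have h1 : z₁ 0 = w₁ 0 := by
    rcases le_total (w₁ 0) (z₁ 0) with hle | hle
    · exact (h.sol.eq_of_le_snd hr hq hlam hv hA hB huv hslope hzw.ge hle).2.symm
    · exact (hv.eq_of_le_snd hr hq hlam h.sol hB hA huv.symm hslope.symm hzw.le hle).2
  exact h.sol.eq_of_initial_eq hr hq hv (fun t => h.u₁_ne_zero hr hq hlam)
    (fun t => h.z₁_ne_zero hr hq hlam) huv hslope hzw h1 ht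

/-- Two bounded solutions, for any two parameters, agree up to scaling. -/
lemma exists_scaling {p μ S : ℝ} (hp : 1 < p) (hpr : (p - 1) * (r - 1) = 1) (hr : 1 < r)
    (hq : 1 < q) (hlam : 0 < lam) (hμ : 0 < μ) (h : IsBoundedSol r q lam T u u₁ z z₁)
    (h' : IsBoundedSol r q μ S v v₁ w w₁) :
    ∃ κ c : ℝ, 0 < κ ∧ c ≠ 0 ∧ lam = κ ^ (2 * p) * |c| ^ (p - q) * μ ∧
      ∀ t, 0 ≤ t → u t = c * v (κ * t) := by
  have ha := h.u₁_ne_zero hr hq hlam h.u_zero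
  have hb := h'.u₁_ne_zero hr hq hμ h'.u_zero
  have hab : 0 < |u₁ 0 / v₁ 0| := abs_pos.2 (div_ne_zero ha hb)
  set a : ℝ := |u₁ 0 / v₁ 0| with ha_def
  have hX : 0 < lam / μ * a ^ (q - p) := by positivity
  -- Matching slopes requires cκ = u'(0)/v'(0), so |c| = a/κ; then lam/μ = κ^{2p} |c|^{p-q} becomes
  -- κ^{p+q} a^{p-q}, which determines κ.
  set κ : ℝ := (lam / μ * a ^ (q - p)) ^ (1 / (p + q)) with hκ_def
  have hκ : 0 < κ := Real.rpow_pos_of_pos hX _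
  have hκpow : κ ^ (p + q) = lam / μ * a ^ (q - p) := by
    rw [hκ_def, ← Real.rpow_mul hX.le, one_div_mul_cancel (by linarith), Real.rpow_one]
  set c : ℝ := u₁ 0 / v₁ 0 / κ with hc_def
  have hc : c ≠ 0 := div_ne_zero (div_ne_zero ha hb) hκ.ne'
  have hcabs : |c| = a / κ := by rw [hc_def, abs_div, abs_of_pos hκ]
  have hpar : lam = κ ^ (2 * p) * |c| ^ (p - q) * μ := by
    rw [hcabs, Real.div_rpow hab.le hκ.le, show 2 * p = (p + q) + (p - q) by ring,
      Real.rpow_add hκ, hκpow, show q - p = -(p - q) by ring, Real.rpow_neg hab.le]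
    have h1 : 0 < a ^ (p - q) := by positivity
    have h2 : 0 < κ ^ (p - q) := by positivity
    field_simp
  refine ⟨κ, c, hκ, hc, hpar, fun t ht => ?_⟩
  have hs := h'.sol.scale hpr hκ hc
  rw [← hpar] at hs
  obtain ⟨B, hB⟩ := h'.bounded_u
  refine h.eq_of_slope_eq hr hq hlam hs (by simp [h'.u_zero]) (by simp [h'.z_zero])
    (B := |c| * B) (fun t => ?_) ?_ ht
  · rw [abs_mul]; exact mul_le_mul_of_nonneg_left (hB _) (abs_nonneg _)
  · simp only [mul_zero, hc_def]
    field_simp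

end IsBoundedSol

/-- The odd `2T`-periodic extension of `f` restricted to `[0, T]`. -/
noncomputable def oddPeriodicExt (T : ℝ) (f : ℝ → ℝ) (t : ℝ) : ℝ :=
  if Even ⌊t / T⌋ then f (t - ⌊t / T⌋ * T) else -f ((⌊t / T⌋ + 1) * T - t)

/-- The even `2T`-periodic extension of `f` restricted to `[0, T]`. -/
noncomputable def evenPeriodicExt (T : ℝ) (f : ℝ → ℝ) (t : ℝ) : ℝ :=
  if Even ⌊t / T⌋ then f (t - ⌊t / T⌋ * T) else f ((⌊t / T⌋ + 1) * T - t)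

/-! ### Odd and even periodic extensions: derivatives, bounds, zeros -/

section PeriodicExt

variable {T : ℝ} {f f₁ : ℝ → ℝ}

lemma floor_div_eq_or (hT : 0 < T) {k : ℤ} {t : ℝ} (ht : t ∈ Icc (k * T) ((k + 1) * T)) :
    ⌊t / T⌋ = k ∨ ⌊t / T⌋ = k + 1 ∧ t = (k + 1) * T := by
  rcases ht.2.lt_or_eq with h | h
  · refine Or.inl (Int.floor_eq_iff.2 ⟨(le_div_iff₀ hT).2 ht.1, (div_lt_iff₀ hT).2 h⟩)
  · refine Or.inr ⟨Int.floor_eq_iff.2 ?_, h⟩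
    rw [h, mul_div_cancel_right₀ _ hT.ne']
    push_cast
    constructor <;> linarith

lemma mem_Icc_floor (hT : 0 < T) (t : ℝ) :
    t ∈ Icc ((⌊t / T⌋ : ℝ) * T) ((⌊t / T⌋ + 1) * T) :=
  ⟨(le_div_iff₀ hT).1 (Int.floor_le _), ((div_lt_iff₀ hT).1 (Int.lt_floor_add_one _)).le⟩

lemma oddPeriodicExt_of_even (hT : 0 < T) (h1 : f T = 0) {k : ℤ} (hk : Even k)
    {t : ℝ} (ht : t ∈ Icc (k * T) ((k + 1) * T)) : oddPeriodicExt T f t = f (t - k * T) := by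
  rcases floor_div_eq_or hT ht with h | ⟨h, rfl⟩
  · rw [oddPeriodicExt, h, if_pos hk]
  · rw [oddPeriodicExt, h, if_neg (by simp [hk])]
    push_cast
    rw [show ((k : ℝ) + 1 + 1) * T - (k + 1) * T = T by ring,
      show ((k : ℝ) + 1) * T - k * T = T by ring, h1, neg_zero]

lemma oddPeriodicExt_of_not_even (hT : 0 < T) (h0 : f 0 = 0) {k : ℤ}
    (hk : ¬ Even k) {t : ℝ} (ht : t ∈ Icc (k * T) ((k + 1) * T)) :
    oddPeriodicExt T f t = -f ((k + 1) * T - t) := by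
  rcases floor_div_eq_or hT ht with h | ⟨h, rfl⟩
  · rw [oddPeriodicExt, h, if_neg hk]
  · rw [oddPeriodicExt, h, if_pos (by simpa [Int.even_add_one] using hk)]
    push_cast
    rw [sub_self, h0, neg_zero]

lemma evenPeriodicExt_of_even (hT : 0 < T) {k : ℤ} (hk : Even k) {t : ℝ}
    (ht : t ∈ Icc (k * T) ((k + 1) * T)) : evenPeriodicExt T f t = f (t - k * T) := by
  rcases floor_div_eq_or hT ht with h | ⟨h, rfl⟩
  · rw [evenPeriodicExt, h, if_pos hk]
  · rw [evenPeriodicExt, h, if_neg (by simp [hk])]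
    push_cast
    congr 1; ring

lemma evenPeriodicExt_of_not_even (hT : 0 < T) {k : ℤ} (hk : ¬ Even k) {t : ℝ}
    (ht : t ∈ Icc (k * T) ((k + 1) * T)) : evenPeriodicExt T f t = f ((k + 1) * T - t) := by
  rcases floor_div_eq_or hT ht with h | ⟨h, rfl⟩
  · rw [evenPeriodicExt, h, if_neg hk]
  · rw [evenPeriodicExt, h, if_pos (by simpa [Int.even_add_one] using hk)]
    push_cast
    congr 1

lemma sub_mem_Icc {k : ℤ} {t : ℝ} (ht : t ∈ Icc (k * T) ((k + 1) * T)) :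
    t - k * T ∈ Icc 0 T := ⟨by linarith [ht.1], by linarith [ht.2]⟩

lemma sub_mem_Icc' {k : ℤ} {t : ℝ} (ht : t ∈ Icc (k * T) ((k + 1) * T)) :
    (k + 1) * T - t ∈ Icc 0 T := ⟨by linarith [ht.2], by linarith [ht.1]⟩

lemma hasDerivAt_of_forall_Icc (hT : 0 < T) {F F₁ : ℝ → ℝ}
    (h : ∀ k : ℤ, ∀ t ∈ Icc (k * T) ((k + 1) * T),
      HasDerivWithinAt F (F₁ t) (Icc (k * T) ((k + 1) * T)) t) (t : ℝ) :
    HasDerivAt F (F₁ t) t := by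
  have ht := mem_Icc_floor hT t
  have hlt : t < (⌊t / T⌋ + 1) * T := (div_lt_iff₀ hT).1 (Int.lt_floor_add_one _)
  rcases ht.1.lt_or_eq with h1 | h1
  · exact (h _ t ht).hasDerivAt (Icc_mem_nhds h1 hlt)
  · have h2 := h (⌊t / T⌋ - 1) t (by push_cast; exact ⟨by linarith, by linarith⟩)
    have h3 := h2.union (h _ t ht)
    push_cast at h3
    refine h3.hasDerivAt ?_
    rw [sub_add_cancel, Icc_union_Icc_eq_Icc (by nlinarith) (by nlinarith)]
    exact Icc_mem_nhds (by linarith) hlt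

lemma hasDerivAt_oddPeriodicExt (hT : 0 < T) (h0 : f 0 = 0) (h1 : f T = 0)
    (hf : ∀ t ∈ Icc 0 T, HasDerivWithinAt f (f₁ t) (Icc 0 T) t) (t : ℝ) :
    HasDerivAt (oddPeriodicExt T f) (evenPeriodicExt T f₁ t) t := by
  refine hasDerivAt_of_forall_Icc hT (fun k t ht => ?_) t
  by_cases hk : Even k
  · rw [evenPeriodicExt_of_even hT hk ht]
    have h := (hf _ (sub_mem_Icc ht)).scomp t (((hasDerivAt_id t).sub_const (k * T)).hasDerivWithinAt
      (s := Icc (k * T) ((k + 1) * T))) fun s hs => sub_mem_Icc hs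
    rw [one_smul] at h
    exact h.congr_of_mem (fun s hs => oddPeriodicExt_of_even hT h1 hk hs) ht
  · rw [evenPeriodicExt_of_not_even hT hk ht]
    have h := ((hf _ (sub_mem_Icc' ht)).scomp t
      (((hasDerivAt_id t).const_sub ((k + 1) * T)).hasDerivWithinAt
      (s := Icc (k * T) ((k + 1) * T))) fun s hs => sub_mem_Icc' hs).neg
    rw [neg_smul, one_smul, neg_neg] at h
    exact h.congr_of_mem (fun s hs => oddPeriodicExt_of_not_even hT h0 hk hs) ht

/-- Even reflection flips the sign of the derivative, so the one-sided derivatives agree at the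
nodes only because `f₁` vanishes at both ends. -/
lemma hasDerivAt_evenPeriodicExt (hT : 0 < T) (h0 : f₁ 0 = 0) (h1 : f₁ T = 0)
    (hf : ∀ t ∈ Icc 0 T, HasDerivWithinAt f (f₁ t) (Icc 0 T) t) (t : ℝ) :
    HasDerivAt (evenPeriodicExt T f) (oddPeriodicExt T f₁ t) t := by
  refine hasDerivAt_of_forall_Icc hT (fun k t ht => ?_) t
  by_cases hk : Even k
  · rw [oddPeriodicExt_of_even hT h1 hk ht]
    have h := (hf _ (sub_mem_Icc ht)).scomp t (((hasDerivAt_id t).sub_const (k * T)).hasDerivWithinAt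
      (s := Icc (k * T) ((k + 1) * T))) fun s hs => sub_mem_Icc hs
    rw [one_smul] at h
    exact h.congr_of_mem (fun s hs => evenPeriodicExt_of_even hT hk hs) ht
  · rw [oddPeriodicExt_of_not_even hT h0 hk ht]
    have h := (hf _ (sub_mem_Icc' ht)).scomp t
      (((hasDerivAt_id t).const_sub ((k + 1) * T)).hasDerivWithinAt
      (s := Icc (k * T) ((k + 1) * T))) fun s hs => sub_mem_Icc' hs
    rw [neg_smul, one_smul] at h
    exact h.congr_of_mem (fun s hs => evenPeriodicExt_of_not_even hT hk hs) ht

lemma oddPeriodicExt_map {g : ℝ → ℝ} (hg : ∀ x, g (-x) = -g x) (t : ℝ) :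
    oddPeriodicExt T (fun s => g (f s)) t = g (oddPeriodicExt T f t) := by
  unfold oddPeriodicExt
  split_ifs
  · rfl
  · rw [hg]

lemma eqOn_oddPeriodicExt (hT : 0 < T) (h1 : f T = 0) :
    EqOn (oddPeriodicExt T f) f (Icc 0 T) := by
  intro t ht
  have := oddPeriodicExt_of_even hT h1 (k := 0) (by simp) (t := t) (by simpa using ht)
  simpa using this

lemma isOddPeriodicExtension_oddPeriodicExt (hT : 0 < T) (h0 : f 0 = 0) (h1 : f T = 0) :
    IsOddPeriodicExtension T f (oddPeriodicExt T f) := by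
  refine ⟨fun t => ?_, fun t => ?_, eqOn_oddPeriodicExt hT h1⟩
  · have ht := mem_Icc_floor hT t
    set k := ⌊t / T⌋
    have ht' : -t ∈ Icc (((-k - 1 : ℤ) : ℝ) * T) (((-k - 1 : ℤ) + 1) * T) := by
      push_cast
      exact ⟨by linarith [ht.2], by linarith [ht.1]⟩
    have hpar : Even (-k - 1) ↔ ¬ Even k := by
      rw [Int.even_sub_one, even_neg]
    by_cases hk : Even k
    · rw [oddPeriodicExt_of_even hT h1 hk ht,
        oddPeriodicExt_of_not_even hT h0 (by simpa [hpar] using hk) ht']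
      push_cast
      congr 2; ring
    · rw [oddPeriodicExt_of_not_even hT h0 hk ht,
        oddPeriodicExt_of_even hT h1 (by simpa [hpar] using hk) ht', neg_neg]
      push_cast
      congr 1; ring
  · have ht := mem_Icc_floor hT t
    set k := ⌊t / T⌋
    have ht' : t + 2 * T ∈ Icc (((k + 2 : ℤ) : ℝ) * T) (((k + 2 : ℤ) + 1) * T) := by
      push_cast
      exact ⟨by linarith [ht.1], by linarith [ht.2]⟩
    have hpar : Even (k + 2) ↔ Even k := by simp
    by_cases hk : Even k
    · rw [oddPeriodicExt_of_even hT h1 hk ht,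
        oddPeriodicExt_of_even hT h1 (hpar.2 hk) ht']
      push_cast
      congr 1; ring
    · rw [oddPeriodicExt_of_not_even hT h0 hk ht,
        oddPeriodicExt_of_not_even hT h0 (by simpa [hpar] using hk) ht']
      push_cast
      congr 2; ring

lemma exists_bound_oddPeriodicExt (hT : 0 < T) (hf : ContinuousOn f (Icc 0 T)) :
    ∃ B, ∀ t, |oddPeriodicExt T f t| ≤ B := by
  obtain ⟨B, hB⟩ := isCompact_Icc.exists_bound_of_continuousOn hf
  refine ⟨B, fun t => ?_⟩
  have ht := mem_Icc_floor hT t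
  unfold oddPeriodicExt
  split_ifs
  · exact hB _ (sub_mem_Icc ht)
  · rw [abs_neg]; exact hB _ (sub_mem_Icc' ht)

lemma oddPeriodicExt_eq_zero_iff (hT : 0 < T) (h0 : f 0 = 0) (h1 : f T = 0)
    (hf : ∀ t ∈ Ioo 0 T, f t ≠ 0) (t : ℝ) :
    oddPeriodicExt T f t = 0 ↔ ∃ k : ℤ, t = k * T := by
  have hzero : ∀ s ∈ Icc 0 T, f s = 0 → s = 0 ∨ s = T := by
    intro s hs hfs
    by_contra hne
    rw [not_or] at hne
    exact hf s ⟨lt_of_le_of_ne hs.1 (Ne.symm hne.1), lt_of_le_of_ne hs.2 hne.2⟩ hfs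
  have key : ∀ k : ℤ, oddPeriodicExt T f (k * T) = 0 := by
    intro k
    have hk : (k : ℝ) * T ∈ Icc (k * T) ((k + 1) * T) := ⟨le_rfl, by linarith⟩
    by_cases he : Even k
    · rw [oddPeriodicExt_of_even hT h1 he hk, sub_self, h0]
    · rw [oddPeriodicExt_of_not_even hT h0 he hk,
        show ((k : ℝ) + 1) * T - k * T = T by ring, h1, neg_zero]
  refine ⟨fun h => ?_, fun ⟨k, hk⟩ => hk ▸ key k⟩
  have ht := mem_Icc_floor hT t
  by_cases he : Even ⌊t / T⌋
  · rw [oddPeriodicExt_of_even hT h1 he ht] at h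
    rcases hzero _ (sub_mem_Icc ht) h with h | h
    · exact ⟨⌊t / T⌋, by linarith⟩
    · exact ⟨⌊t / T⌋ + 1, by push_cast; linarith⟩
  · rw [oddPeriodicExt_of_not_even hT h0 he ht, neg_eq_zero] at h
    rcases hzero _ (sub_mem_Icc' ht) h with h | h
    · exact ⟨⌊t / T⌋ + 1, by push_cast; linarith⟩
    · exact ⟨⌊t / T⌋, by linarith⟩

end PeriodicExt

/-! ### Passage between the eigenvalue problem and the system -/

lemma ContDiffOn.hasDerivWithinAt_secondDeriv {T : ℝ} (hT : 0 < T) {f : ℝ → ℝ}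
    (hf : ContDiffOn ℝ 2 f (Icc 0 T)) {t : ℝ} (ht : t ∈ Icc 0 T) :
    HasDerivWithinAt f (derivWithin f (Icc 0 T) t) (Icc 0 T) t ∧
      HasDerivWithinAt (derivWithin f (Icc 0 T)) (secondDeriv T f t) (Icc 0 T) t := by
  have hu := uniqueDiffOn_Icc hT
  rw [show (2 : WithTop ℕ∞) = 1 + 1 by norm_num, contDiffOn_succ_iff_derivWithin hu] at hf
  refine ⟨(hf.1 t ht).hasDerivWithinAt, ?_⟩
  have h2 := ((hf.2.2.differentiableOn (by norm_num)) t ht).hasDerivWithinAt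
  have h3 : secondDeriv T f t = derivWithin (derivWithin f (Icc 0 T)) (Icc 0 T) t := by
    rw [secondDeriv, iteratedDerivWithin_succ, iteratedDerivWithin_one]
  rwa [h3]

lemma contDiff_two_of_hasDerivAt {f f₁ f₂ : ℝ → ℝ} (hf : ∀ t, HasDerivAt f (f₁ t) t)
    (hf₁ : ∀ t, HasDerivAt f₁ (f₂ t) t) (hf₂ : Continuous f₂) : ContDiff ℝ 2 f := by
  have h1 : deriv f = f₁ := funext fun t => (hf t).deriv
  have h2 : deriv f₁ = f₂ := funext fun t => (hf₁ t).deriv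
  rw [show (2 : WithTop ℕ∞) = 1 + 1 by norm_num, contDiff_succ_iff_deriv, h1,
    contDiff_one_iff_deriv, h2]
  exact ⟨fun t => (hf t).differentiableAt, by simp, fun t => (hf₁ t).differentiableAt, hf₂⟩

lemma secondDeriv_eq_of_hasDerivAt {T : ℝ} (hT : 0 < T) {f f₁ f₂ : ℝ → ℝ}
    (hf : ∀ t, HasDerivAt f (f₁ t) t) (hf₁ : ∀ t, HasDerivAt f₁ (f₂ t) t) {t : ℝ}
    (ht : t ∈ Icc 0 T) : secondDeriv T f t = f₂ t := by
  have hu := uniqueDiffOn_Icc hT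
  have h1 : EqOn (derivWithin f (Icc 0 T)) f₁ (Icc 0 T) := fun s hs =>
    (hf s).hasDerivWithinAt.derivWithin (hu s hs)
  rw [secondDeriv, iteratedDerivWithin_succ, iteratedDerivWithin_one, derivWithin_congr h1 (h1 ht)]
  exact (hf₁ t).hasDerivWithinAt.derivWithin (hu t ht)

/-- The vanishing of u and u'' at both ends is exactly what glues u, u', z and z' differentiably at
the nodes. -/
lemma IsEigenfunction.exists_isBoundedSol {p q r lam T : ℝ}
    (hpr : (p - 1) * (r - 1) = 1) (hT : 0 < T) {u : ℝ → ℝ} (hu : IsEigenfunction p q lam T u) :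
    ∃ u₁ z z₁ : ℝ → ℝ, IsBoundedSol r q lam T (oddPeriodicExt T u) u₁ z z₁ ∧
      ∀ t ∈ Icc 0 T, secondDeriv T u t = -signedPow r (z t) := by
  have hpr' : (r - 1) * (p - 1) = 1 := by rw [mul_comm]; exact hpr
  set ζ : ℝ → ℝ := fun t => signedPow p (secondDeriv T u t) with hζ
  have hu1 := fun t ht => hu.contDiffOn.hasDerivWithinAt_secondDeriv hT (t := t) ht
  have hζ1 := fun t ht => hu.contDiffOn_signedPow.hasDerivWithinAt_secondDeriv hT (t := t) ht
  have hz0 : -ζ 0 = 0 := by simp [hζ, hu.secondDeriv_left, signedPow_zero]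
  have hzT : -ζ T = 0 := by simp [hζ, hu.secondDeriv_right, signedPow_zero]
  have hinv : ∀ t, secondDeriv T u t = -signedPow r (-ζ t) := fun t => by
    rw [signedPow_neg, neg_neg, hζ, signedPow_signedPow hpr']
  have hmem0 : (0 : ℝ) ∈ Icc 0 T := ⟨le_rfl, hT.le⟩
  have hmemT : T ∈ Icc 0 T := ⟨hT.le, le_rfl⟩
  have hsol : IsSystemSol r q lam (oddPeriodicExt T u) (evenPeriodicExt T (derivWithin u (Icc 0 T)))
      (oddPeriodicExt T fun t => -ζ t)
      (evenPeriodicExt T fun t => -derivWithin ζ (Icc 0 T) t) := by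
    refine ⟨hasDerivAt_oddPeriodicExt hT hu.left hu.right fun t ht => (hu1 t ht).1, fun t => ?_,
      hasDerivAt_oddPeriodicExt hT hz0 hzT fun t ht => (hζ1 t ht).1.neg, fun t => ?_⟩
    · rw [← oddPeriodicExt_map (g := fun x => -signedPow r x) (by simp [signedPow_neg]),
        ← funext hinv]
      exact hasDerivAt_evenPeriodicExt hT hu.secondDeriv_left hu.secondDeriv_right
        (fun t ht => (hu1 t ht).2) t
    · rw [← oddPeriodicExt_map (g := fun x => -(lam * signedPow q x)) (by simp [signedPow_neg])]
      refine hasDerivAt_evenPeriodicExt hT (by simp [hu.left, signedPow_zero])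
        (by simp [hu.right, signedPow_zero]) (fun t ht => ?_) t
      rw [← hu.equation t ht]
      exact (hζ1 t ht).2.neg
  have hEu := eqOn_oddPeriodicExt hT hu.right
  have hEz := eqOn_oddPeriodicExt (f := fun t => -ζ t) hT hzT
  refine ⟨_, _, _, ⟨hsol, ?_, ?_, ?_, ?_, ?_, ?_, ?_⟩, fun t ht => ?_⟩
  · rw [hEu hmem0, hu.left]
  · exact (hEz hmem0).trans hz0
  · rw [hEu hmemT, hu.right]
  · exact (hEz hmemT).trans hzT
  · exact exists_bound_oddPeriodicExt hT hu.contDiffOn.continuousOn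
  · exact exists_bound_oddPeriodicExt hT hu.contDiffOn_signedPow.continuousOn.neg
  · obtain ⟨t, ht, hne⟩ := hu.nonzero
    refine ⟨t, ⟨lt_of_le_of_ne ht.1 ?_, lt_of_le_of_ne ht.2 ?_⟩, by rwa [hEu ht]⟩
    · rintro rfl; exact hne hu.left
    · rintro rfl; exact hne hu.right
  · rw [hinv t, hEz ht]

lemma IsSystemSol.isEigenfunction {p q r lam T : ℝ} (hr : 1 < r) (hq : 1 < q)
    (hpr : (p - 1) * (r - 1) = 1) (hT : 0 < T) {u u₁ z z₁ : ℝ → ℝ}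
    (hu : IsSystemSol r q lam u u₁ z z₁) (hu0 : u 0 = 0) (huT : u T = 0) (hz0 : z 0 = 0)
    (hzT : z T = 0) (hne : ∃ t ∈ Icc 0 T, u t ≠ 0) : IsEigenfunction p q lam T u := by
  obtain ⟨cu, -, cz, -⟩ := hu.continuous_all
  have hmem0 : (0 : ℝ) ∈ Icc 0 T := ⟨le_rfl, hT.le⟩
  have hmemT : T ∈ Icc 0 T := ⟨hT.le, le_rfl⟩
  have h2 : ∀ t ∈ Icc 0 T, secondDeriv T u t = -signedPow r (z t) := fun t ht =>
    secondDeriv_eq_of_hasDerivAt hT hu.hasDerivAt_u hu.hasDerivAt_u₁ ht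
  have hE : EqOn (fun t => signedPow p (secondDeriv T u t)) (fun t => -z t) (Icc 0 T) := by
    intro t ht
    simp only [h2 t ht, signedPow_neg, signedPow_signedPow hpr]
  have hz := fun t => (hu.hasDerivAt_z t).fun_neg
  have hz₁ : ∀ t, HasDerivAt (fun t => -z₁ t) (lam * signedPow q (u t)) t := fun t => by
    simpa using (hu.hasDerivAt_z₁ t).fun_neg
  refine ⟨?_, ?_, fun t ht => ?_, hu0, huT, ?_, ?_, hne⟩
  · exact (contDiff_two_of_hasDerivAt hu.hasDerivAt_u hu.hasDerivAt_u₁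
      ((continuous_signedPow hr).comp cz).neg).contDiffOn
  · exact (contDiff_two_of_hasDerivAt hz hz₁
      (((continuous_signedPow hq).comp cu).const_mul lam)).contDiffOn.congr hE
  · rw [← secondDeriv_eq_of_hasDerivAt hT hz hz₁ ht]
    exact iteratedDerivWithin_congr hE ht
  · rw [h2 0 hmem0, hz0, signedPow_zero, neg_zero]
  · rw [h2 T hmemT, hzT, signedPow_zero, neg_zero]

/-! ### Existence of a first eigenfunction and equidistant zeros -/

lemma mul_pos_of_forall_Ioo_ne_zero {f : ℝ → ℝ} (hf : Continuous f) {a b x y : ℝ}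
    (h : ∀ t ∈ Ioo a b, f t ≠ 0) (hx : x ∈ Ioo a b) (hy : y ∈ Ioo a b) : 0 < f x * f y := by
  by_contra hneg
  have hmem : (0 : ℝ) ∈ uIcc (f x) (f y) := by
    rcases mul_nonpos_iff.1 (not_lt.1 hneg) with h | h
    · exact mem_uIcc.2 (Or.inr ⟨h.2, h.1⟩)
    · exact mem_uIcc.2 (Or.inl h)
  obtain ⟨t, ht, h0⟩ := intermediate_value_uIcc hf.continuousOn hmem
  exact h t (ordConnected_Ioo.uIcc_subset hx hy ht) h0

/-- Rescaling an eigenfunction on the interval up to its first zero gives a first eigenfunction. -/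
lemma IsBoundedSol.exists_isFirstEigenfunction {p q r lam T : ℝ} (hr : 1 < r) (hq : 1 < q)
    (hpr : (p - 1) * (r - 1) = 1) (hlam : 0 < lam) (hT : 0 < T) {u u₁ z z₁ : ℝ → ℝ}
    (h : IsBoundedSol r q lam T u u₁ z z₁) (hfin : {t | t ∈ Ioo 0 T ∧ u t = 0}.Finite) :
    ∃ (μ : ℝ) (v : ℝ → ℝ), 0 < μ ∧ IsFirstEigenfunction p q μ T v := by
  -- Inserting `T` provides a first zero even when there is none inside.
  obtain ⟨s, hs, hmin⟩ := exists_min_image _ id (hfin.insert T) ⟨T, mem_insert _ _⟩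
  have hs' : 0 < s ∧ s ≤ T ∧ u s = 0 := by
    rcases hs with rfl | hs
    · exact ⟨hT, le_rfl, h.u_right⟩
    · exact ⟨hs.1.1, hs.1.2.le, hs.2⟩
  obtain ⟨hs0, hsT, hus⟩ := hs'
  have hne : ∀ t ∈ Ioo 0 s, u t ≠ 0 := fun t ht h0 =>
    absurd (hmin t (Or.inr ⟨⟨ht.1, ht.2.trans_le hsT⟩, h0⟩)) (not_le.2 ht.2)
  have hmid : s / 2 ∈ Ioo 0 s := ⟨by linarith, by linarith⟩
  have hκ : 0 < s / T := div_pos hs0 hT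
  have hκT : s / T * T = s := div_mul_cancel₀ _ hT.ne'
  -- The amplitude `u (s / 2)` has the constant sign of `u` on `(0, s)`, so the rescaled function is
  -- positive.
  have hsol := h.sol.scale hpr hκ (hne _ hmid)
  have hpos : ∀ t ∈ Ioo 0 T, 0 < u (s / 2) * u (s / T * t) := fun t ht =>
    mul_pos_of_forall_Ioo_ne_zero h.sol.continuous_all.1 hne hmid
      ⟨mul_pos hκ ht.1, by
        calc s / T * t < s / T * T := mul_lt_mul_of_pos_left ht.2 hκ
          _ = s := hκT⟩
  refine ⟨_, _, ?_, hsol.isEigenfunction hr hq hpr hT ?_ ?_ ?_ ?_ ?_, hpos⟩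
  · have := abs_pos.2 (hne _ hmid)
    positivity
  · simp [h.u_zero]
  · simp [hκT, hus]
  · simp [h.z_zero]
  · simp [hκT, h.z_eq_zero hr hq hlam hus]
  · exact ⟨T / 2, ⟨by linarith, by linarith⟩, (hpos (T / 2) ⟨by linarith, by linarith⟩).ne'⟩

lemma encard_equidistant {T : ℝ} (hT : 0 < T) {m : ℕ} (hm : 1 ≤ m) :
    {t : ℝ | ∃ j : ℕ, 1 ≤ j ∧ j ≤ m - 1 ∧ t = (j : ℝ) * T / (m : ℝ)}.encard
      = ((m - 1 : ℕ) : ℕ∞) := by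
  have hm0 : (m : ℝ) ≠ 0 := by positivity
  have himg : {t : ℝ | ∃ j : ℕ, 1 ≤ j ∧ j ≤ m - 1 ∧ t = (j : ℝ) * T / (m : ℝ)}
      = (fun j : ℕ => (j : ℝ) * T / (m : ℝ)) '' (Finset.Icc 1 (m - 1) : Finset ℕ) := by
    ext t
    simp only [mem_ofPred_eq, mem_image, Finset.coe_Icc, mem_Icc, and_assoc, eq_comm]
  have hinj : Function.Injective fun j : ℕ => (j : ℝ) * T / (m : ℝ) := fun i j hij => by
    have h1 := mul_right_cancel₀ hT.ne' ((div_left_inj' hm0).1 hij)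
    exact_mod_cast h1
  rw [himg, hinj.encard_image, encard_coe_eq_coe_finsetCard, Nat.card_Icc, Nat.add_sub_cancel]

/-- An eigenfunction is a rescaled copy of the extension of any first eigenfunction, and its zeros
are equidistant. -/
lemma IsBoundedSol.eq_scaled_firstEigenfunction {p q r lam μ T : ℝ} (hp : 1 < p) (hr : 1 < r)
    (hq : 1 < q) (hpr : (p - 1) * (r - 1) = 1) (hlam : 0 < lam) (hμ : 0 < μ) (hT : 0 < T)
    {u u₁ z z₁ v : ℝ → ℝ} (h : IsBoundedSol r q lam T u u₁ z z₁)
    (hv : IsFirstEigenfunction p q μ T v) :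
    ∃ (m : ℕ) (c : ℝ), 1 ≤ m ∧ c ≠ 0 ∧ lam = (m : ℝ) ^ (2 * p) * |c| ^ (p - q) * μ ∧
      (∀ t ∈ Icc 0 T, u t = c * oddPeriodicExt T v (m * t)) ∧
      {t : ℝ | t ∈ Ioo 0 T ∧ u t = 0}
        = {t : ℝ | ∃ j : ℕ, 1 ≤ j ∧ j ≤ m - 1 ∧ t = (j : ℝ) * T / (m : ℝ)} := by
  obtain ⟨v₁, w, w₁, hv', -⟩ := hv.isEigenfunction.exists_isBoundedSol hpr hT
  obtain ⟨κ, c, hκ, hc, hpar, heq⟩ := h.exists_scaling hp hpr hr hq hlam hμ hv'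
  have hzero : ∀ t, 0 ≤ t → (u t = 0 ↔ ∃ k : ℤ, κ * t = k * T) := fun t ht => by
    rw [heq t ht, mul_eq_zero, or_iff_right hc, oddPeriodicExt_eq_zero_iff hT
      hv.isEigenfunction.left hv.isEigenfunction.right fun t ht => (hv.pos t ht).ne']
  -- The extension of `v` vanishes only at multiples of `T`, so `u T = 0` makes `κ` an integer.
  obtain ⟨k, hk⟩ := (hzero T hT.le).1 h.u_right
  have hk' : κ = k := mul_right_cancel₀ hT.ne' hk
  have hk0 : 0 < k := by rw [hk'] at hκ; exact_mod_cast hκ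
  obtain ⟨m, rfl⟩ := Int.eq_ofNat_of_zero_le hk0.le
  have hm : 1 ≤ m := by exact_mod_cast hk0
  obtain rfl : κ = (m : ℝ) := by rw [hk']; simp
  refine ⟨m, c, hm, hc, hpar, fun t ht => heq t ht.1, ?_⟩
  ext t
  simp only [mem_ofPred_eq]
  constructor
  · rintro ⟨ht, h0⟩
    obtain ⟨i, hi⟩ := (hzero t ht.1.le).1 h0
    have hi0 : (0 : ℝ) < i := pos_of_mul_pos_left (hi ▸ mul_pos hκ ht.1) hT.le
    have him : (i : ℝ) < m := by
      refine lt_of_mul_lt_mul_right ?_ hT.le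
      rw [← hi]; exact mul_lt_mul_of_pos_left ht.2 hκ
    have hi0' : 0 < i := by exact_mod_cast hi0
    obtain ⟨j, rfl⟩ := Int.eq_ofNat_of_zero_le hi0'.le
    have hjm : j < m := by exact_mod_cast him
    refine ⟨j, by exact_mod_cast hi0', by omega, ?_⟩
    rw [eq_div_iff hκ.ne', mul_comm, hi]; simp
  · rintro ⟨j, hj1, hjm, rfl⟩
    have hj0 : (0 : ℝ) < j := by exact_mod_cast hj1
    have hjm' : (j : ℝ) < m := by exact_mod_cast (by omega : j < m)
    have hpos : 0 < (j : ℝ) * T / m := by positivity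
    refine ⟨⟨hpos, ?_⟩, (hzero _ hpos.le).2 ⟨j, ?_⟩⟩
    · rw [div_lt_iff₀ hκ, mul_comm]; exact mul_lt_mul_of_pos_left hjm' hT
    · push_cast; field_simp

theorem mainTheorem3 (p q : ℝ) (hp : 1 < p) (hq : 1 < q) (t₀ : ℝ) (ht₀ : 0 < t₀)
    (lam : ℝ) (hlam : 0 < lam) (u : ℝ → ℝ) (hu : IsEigenfunction p q lam t₀ u)
    (n : ℕ) (hn : 1 ≤ n)
    (hzeros : {t : ℝ | t ∈ Ioo 0 t₀ ∧ u t = 0}.encard = ((n - 1 : ℕ) : ℕ∞)) :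
    {t : ℝ | t ∈ Ioo 0 t₀ ∧ u t = 0}
        = {t : ℝ | ∃ j : ℕ, 1 ≤ j ∧ j ≤ n - 1 ∧ t = (j : ℝ) * t₀ / (n : ℝ)} ∧
    (∀ t ∈ Ioo 0 t₀, u t = 0 → deriv u t ≠ 0) ∧
    {t : ℝ | t ∈ Ioo 0 t₀ ∧ secondDeriv t₀ u t = 0}
        = {t : ℝ | ∃ j : ℕ, 1 ≤ j ∧ j ≤ n - 1 ∧ t = (j : ℝ) * t₀ / (n : ℝ)} ∧
    (∃ (μ : ℝ) (v : ℝ → ℝ), 0 < μ ∧ IsFirstEigenfunction p q μ t₀ v) ∧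
    (∀ (μ : ℝ) (v : ℝ → ℝ), 0 < μ → IsFirstEigenfunction p q μ t₀ v →
      ∃ w : ℝ → ℝ, IsOddPeriodicExtension t₀ v w ∧
        ∃ c : ℝ, c ≠ 0 ∧ lam = (n : ℝ) ^ (2 * p) * |c| ^ (p - q) * μ ∧
          ∀ t ∈ Icc 0 t₀, u t = c * w ((n : ℝ) * t)) := by
  obtain ⟨r, hr, hpr⟩ : ∃ r : ℝ, 1 < r ∧ (p - 1) * (r - 1) = 1 := by
    have hp1 : 0 < p - 1 := by linarith
    refine ⟨1 + (p - 1)⁻¹, by linarith [inv_pos.2 hp1], ?_⟩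
    rw [add_sub_cancel_left, mul_inv_cancel₀ hp1.ne']
  obtain ⟨u₁, z, z₁, hU, hz⟩ := hu.exists_isBoundedSol hpr ht₀
  have hE := eqOn_oddPeriodicExt ht₀ hu.right
  have hset : {t : ℝ | t ∈ Ioo 0 t₀ ∧ oddPeriodicExt t₀ u t = 0}
      = {t : ℝ | t ∈ Ioo 0 t₀ ∧ u t = 0} := by
    ext t
    exact and_congr_right fun ht => by rw [hE (Ioo_subset_Icc_self ht)]
  have hfirst := hU.exists_isFirstEigenfunction hr hq hpr hlam ht₀
    (hset ▸ finite_of_encard_eq_coe hzeros)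
  have key : ∀ (μ : ℝ) (v : ℝ → ℝ), 0 < μ → IsFirstEigenfunction p q μ t₀ v →
      {t : ℝ | t ∈ Ioo 0 t₀ ∧ u t = 0}
        = {t : ℝ | ∃ j : ℕ, 1 ≤ j ∧ j ≤ n - 1 ∧ t = (j : ℝ) * t₀ / (n : ℝ)} ∧
      ∃ c : ℝ, c ≠ 0 ∧ lam = (n : ℝ) ^ (2 * p) * |c| ^ (p - q) * μ ∧
        ∀ t ∈ Icc 0 t₀, u t = c * oddPeriodicExt t₀ v ((n : ℝ) * t) := by
    intro μ v hμ hv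
    obtain ⟨m, c, hm, hc, hpar, heq, hzs⟩ :=
      hU.eq_scaled_firstEigenfunction hp hr hq hpr hlam hμ ht₀ hv
    rw [hset] at hzs
    have hcard := encard_equidistant ht₀ hm
    rw [← hzs, hzeros, Nat.cast_inj] at hcard
    -- The truncated differences `m - 1` and `n - 1` determine `m` and `n` because both are at least
    -- 1.
    obtain rfl : m = n := by omega
    exact ⟨hzs, c, hc, hpar, fun t ht => by rw [← heq t ht, hE ht]⟩
  have hzs : {t : ℝ | t ∈ Ioo 0 t₀ ∧ u t = 0}
      = {t : ℝ | ∃ j : ℕ, 1 ≤ j ∧ j ≤ n - 1 ∧ t = (j : ℝ) * t₀ / (n : ℝ)} := by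
    obtain ⟨μ, v, hμ, hv⟩ := hfirst
    exact (key μ v hμ hv).1
  refine ⟨hzs, fun t ht h0 => ?_, ?_, hfirst, fun μ v hμ hv => ?_⟩
  · have hnear : u =ᶠ[nhds t] oddPeriodicExt t₀ u :=
      Filter.eventually_of_mem (Icc_mem_nhds ht.1 ht.2) fun s hs => (hE hs).symm
    rw [((hU.sol.hasDerivAt_u t).congr_of_eventuallyEq hnear).deriv]
    exact hU.u₁_ne_zero hr hq hlam (by rw [hE (Ioo_subset_Icc_self ht), h0])
  · rw [← hzs]
    ext t
    refine and_congr_right fun ht => ?_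
    have ht' := Ioo_subset_Icc_self ht
    rw [hz t ht', neg_eq_zero, signedPow_eq_zero_iff, ← hU.u_eq_zero_iff hr hq hlam, hE ht']
  · exact ⟨_, isOddPeriodicExtension_oddPeriodicExt ht₀ hv.isEigenfunction.left
      hv.isEigenfunction.right, (key μ v hμ hv).2⟩
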